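/- Let $L\ge 1$ be an integer and let $\mathbf X=(X_1,\dots,X_L)$ be a zero-mean multivariate Gaussian vector in $\mathbb R^L$ with (positive semidefinite) covariance matrix $\mathbf K_{\mathbf X}$. For $\mathbf D=(D_1,\dots,D_L)\in[0,\infty)^L$ and $C\in[0,\infty)$, define the Gaussian rate-distortion-cache function $$R_{\mathrm G}(\mathbf D,C)=\inf_{(U,\hat{\mathbf X})}\ \max_{1\le \ell\le L} I(X_\ell;\hat X_\ell\mid U)\in[0,\infty],$$ where the infimum is over all real random tuples $(U,\hat X_1,\dots,\hat X_L)$ jointly distributed with $\mathbf X$ such that $$I(\mathbf X;U)\le C\qquad\text{and}\qquad \mathbb E\big[(X_\ell-\hat X_\ell)^2\big]\le D_\ell\quad\text{for all }\ell .$$ For a nonempty $S\subseteq\{1,\dots,L\}$ let $\mathbf K_{X_S}$ be the covariance matrix of $X_S=(X_\ell)_{\ell\in S}$. Logarithms and information measures are in base $2$. Then for every $D\ge 0$ and $C\ge 0$, $$R_{\mathrm G}\big((D,\dots,D),C\big)\ \ge\ \max_{\emptyset\ne S\subseteq\{1,\dots,L\}}\left[\frac{1}{2|S|}\log\frac{\det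 \mathbf K_{X_S}}{D^{|S|}}-\frac{C}{|S|}\right],$$ where the bracket is read as $-\infty$ if $\det\mathbf K_{X_S}=0$, and as $+\infty$ if $D=0<\det\mathbf K_{X_S}$. -/

import Mathlib

open MeasureTheory ProbabilityTheory InformationTheory
open scoped ENNReal NNReal

/-- The logarithm to base `2` on `[0, ∞]`, with `log2 0 = -∞` and `log2 ∞ = +∞`. -/
noncomputable def log2 (x : ℝ≥0∞) : EReal := ENNReal.log x / ((Real.log 2 : ℝ) : EReal)

/-- Mutual information `I(X; Y)` in bits of two random variables on `(Ω, P)`: the Kullback-Leibler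
divergence of the joint law from the product of the marginal laws. -/
noncomputable def mutualInfo {Ω α β : Type*} [MeasurableSpace Ω] [MeasurableSpace α]
    [MeasurableSpace β] (X : Ω → α) (Y : Ω → β) (P : Measure Ω) : ℝ≥0∞ :=
  klDiv (P.map fun ω => (X ω, Y ω)) ((P.map X).prod (P.map Y)) / ENNReal.ofReal (Real.log 2)

/-- Conditional mutual information `I(X; Y | U)` in bits: the Kullback-Leibler divergence of the
law of `(U, (X, Y))` from the law under which `U` has the same distribution and, given `U`, the
variables `X` and `Y` are independent with their conditional distributions given `U`. -/
noncomputable def condMutualInfo {Ω α β γ : Type*} [MeasurableSpace Ω]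
    [MeasurableSpace α] [StandardBorelSpace α] [Nonempty α]
    [MeasurableSpace β] [StandardBorelSpace β] [Nonempty β] [MeasurableSpace γ]
    (X : Ω → α) (Y : Ω → β) (U : Ω → γ) (P : Measure Ω) [IsFiniteMeasure P] : ℝ≥0∞ :=
  klDiv (P.map fun ω => (U ω, (X ω, Y ω)))
    ((P.map U) ⊗ₘ (condDistrib X U P ×ₖ condDistrib Y U P)) / ENNReal.ofReal (Real.log 2)

/-- The space of values `(x, u, x̂)` of the source vector `X`, the real auxiliary variable `U` and
the reconstruction vector `X̂`. -/
abbrev RDCSpace (L : ℕ) : Type :=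
  EuclideanSpace ℝ (Fin L) × ℝ × EuclideanSpace ℝ (Fin L)

/-- `P` is the joint law of a tuple `(X, U, X̂)` in which `X` is a zero mean Gaussian vector with
covariance matrix `K`, the cache constraint `I(X; U) ≤ C` holds, and
`𝔼[(X_ℓ - X̂_ℓ)²] ≤ D_ℓ` for every `ℓ`. -/
structure IsGaussianRDCFeasible {L : ℕ} (K : Matrix (Fin L) (Fin L) ℝ) (D : Fin L → ℝ≥0)
    (C : ℝ≥0) (P : Measure (RDCSpace L)) : Prop where
  source_law : P.map (fun ω => ω.1) = multivariateGaussian 0 K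
  cache_le : mutualInfo (fun ω : RDCSpace L => ω.1) (fun ω => ω.2.1) P ≤ C
  distortion_le : ∀ l : Fin L, ∫⁻ ω, ENNReal.ofReal ((ω.1 l - ω.2.2 l) ^ 2) ∂P ≤ D l

/-- The Gaussian rate-distortion-cache function
`R_G(D, C) = inf_{(U, X̂)} max_ℓ I(X_ℓ; X̂_ℓ | U)`. -/
noncomputable def gaussianRDC {L : ℕ} (K : Matrix (Fin L) (Fin L) ℝ) (D : Fin L → ℝ≥0)
    (C : ℝ≥0) : ℝ≥0∞ :=
  ⨅ (P : ProbabilityMeasure (RDCSpace L))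
    (_ : IsGaussianRDCFeasible K D C (P : Measure (RDCSpace L))),
    ⨆ l : Fin L, condMutualInfo (fun ω : RDCSpace L => ω.1 l) (fun ω => ω.2.2 l)
      (fun ω => ω.2.1) (P : Measure (RDCSpace L))

/-- The covariance matrix `K_{X_S}` of the subvector `X_S = (X_ℓ : ℓ ∈ S)` of a vector `X` with
covariance matrix `K`. -/
def subCov {L : ℕ} (K : Matrix (Fin L) (Fin L) ℝ) (S : Finset (Fin L)) : Matrix S S ℝ :=
  K.submatrix (fun i => (i : Fin L)) (fun j => (j : Fin L))

/-- `(1 / (2|S|)) log₂ (det K_{X_S} / D^{|S|}) - C / |S|`, with values in `[-∞, ∞]`: it is `+∞` if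
`D = 0 < det K_{X_S}`, and `-∞` if `det K_{X_S} = 0`. -/
noncomputable def subsetBound {L : ℕ} (K : Matrix (Fin L) (Fin L) ℝ) (D C : ℝ≥0)
    (S : Finset (Fin L)) : EReal :=
  ((1 / (2 * (S.card : ℝ)) : ℝ) : EReal)
      * log2 (ENNReal.ofReal (subCov K S).det / (D : ℝ≥0∞) ^ S.card)
    - (((C : ℝ) / (S.card : ℝ) : ℝ) : EReal)

/-! In entropy terms, for each `ℓ ∈ S`, `I(X_ℓ; X̂_ℓ | U) ≥ h(X_ℓ | U) - ½ log(2πeD)`, because a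
variable with second moment at most `D` has entropy at most that of a Gaussian. Moreover `∑ h(X_ℓ |
U) ≥ h(X_S | U) ≥ h(X_S) - I(X; U)`, by subadditivity and data processing. Summing over `S`,
inserting the Gaussian value of `h(X_S)` and bounding each rate by the maximum gives the claim.

Conditional entropies need not be finite, so the proof works with test functions in a variational
bound for divergence. With `q_ℓ` the conditional density of `X_ℓ` given `U`, `w` the Gaussian
density of variance `D` at `x - x̂`, and `g` the density of `X_S`, the rates are tested with `w /
q_ℓ` and the cache information with `∏ q_ℓ / g`. Each has integral at most 1 under its reference law
(`lintegral_div_condDensity_le_one`, `lintegral_prod_condDensity_div_le_one`). On adding logarithms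
every `q_ℓ` cancels pointwise, before any integration; `∑ log w - log g` remains, and its
expectation is explicit or bounded by the distortion constraint (`sum_klDiv_add_klDiv_ge`). -/

/-! ### Variational bound for the divergence -/

/-- A Donsker-Varadhan type bound: if `∫ f dν ≤ 1`, then `log f` is dominated by an integrable
function whose `μ`-integral is at most the divergence of `μ` from `ν`. -/
theorem exists_integrable_log_le_of_klDiv_ne_top {α : Type*} [MeasurableSpace α]
    {μ ν : Measure α} [IsProbabilityMeasure μ] [IsProbabilityMeasure ν] (h : klDiv μ ν ≠ ∞)
    {f : α → ℝ≥0∞} (hf : Measurable f) (hf1 : ∫⁻ x, f x ∂ν ≤ 1)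
    (hpos : ∀ᵐ x ∂μ, f x ≠ 0) (hfin : ∀ᵐ x ∂μ, f x ≠ ∞) :
    ∃ g : α → ℝ, Integrable g μ ∧ ∫ x, g x ∂μ ≤ (klDiv μ ν).toReal ∧
      ∀ᵐ x ∂μ, Real.log (f x).toReal ≤ g x := by
  obtain ⟨hac, hint⟩ := klDiv_ne_top_iff.1 h
  set r := μ.rnDeriv ν with hr
  have hrm : Measurable r := Measure.measurable_rnDeriv _ _
  have hw : ∫⁻ x, f x / r x ∂μ ≤ 1 := by
    rw [← lintegral_rnDeriv_mul hac (f := fun x => f x / r x) (hf.div hrm).aemeasurable]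
    exact (lintegral_mono fun x => ENNReal.mul_div_le).trans hf1
  have hwm : Measurable fun x => f x / r x := hf.div hrm
  have hwfin := ae_lt_top hwm (ne_top_of_le_ne_top ENNReal.one_ne_top hw)
  have hwint : Integrable (fun x => (f x / r x).toReal) μ :=
    integrable_toReal_of_lintegral_ne_top hwm.aemeasurable
      (ne_top_of_le_ne_top ENNReal.one_ne_top hw)
  -- The majorant comes from `log (f / r) ≤ f / r - 1`. It is integrable even when `log f` is not.
  refine ⟨fun x => llr μ ν x + ((f x / r x).toReal - 1),
    hint.add (hwint.sub (integrable_const 1)), ?_, ?_⟩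
  · rw [integral_add (g := fun x => (f x / r x).toReal - 1) hint
        (hwint.sub (integrable_const 1)), integral_sub hwint (integrable_const 1), toReal_klDiv_of_measure_eq hac (by simp),
      integral_toReal hwm.aemeasurable hwfin]
    have := ENNReal.toReal_mono ENNReal.one_ne_top hw
    simp only [ENNReal.toReal_one] at this
    simp only [integral_const, probReal_univ, smul_eq_mul, mul_one]
    linarith
  · filter_upwards [hpos, hfin, Measure.rnDeriv_pos hac,
      hac.ae_le (Measure.rnDeriv_lt_top μ ν)] with x h0 h1 h2 h3
    have hf0 : 0 < (f x).toReal := ENNReal.toReal_pos h0 h1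
    have hr0 : 0 < (r x).toReal := ENNReal.toReal_pos h2.ne' h3.ne
    have := Real.log_le_sub_one_of_pos (div_pos hf0 hr0)
    rw [Real.log_div hf0.ne' hr0.ne'] at this
    rw [ENNReal.toReal_div, llr, ← hr]
    linarith

/-! ### Product densities and linear change of variables -/

theorem lintegral_fin_prod_eq_prod {n : ℕ} {E : Fin n → Type*} [∀ i, MeasurableSpace (E i)]
    (μ : ∀ i, Measure (E i)) [∀ i, SigmaFinite (μ i)] {f : ∀ i, E i → ℝ≥0∞}
    (hf : ∀ i, Measurable (f i)) :
    ∫⁻ x, ∏ i, f i (x i) ∂Measure.pi μ = ∏ i, ∫⁻ x, f i x ∂μ i := by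
  induction n with
  | zero => simp
  | succ n ih =>
    have hm : Measurable fun x : ∀ i, E (Fin.succ i) => ∏ i, f (Fin.succ i) (x i) :=
      Finset.measurable_prod _ fun i _ => (hf _).comp (measurable_pi_apply i)
    calc ∫⁻ x, ∏ i, f i (x i) ∂Measure.pi μ
      _ = ∫⁻ x : E 0 × (∀ i, E (Fin.succ i)), f 0 x.1 * ∏ i, f (Fin.succ i) (x.2 i)
          ∂(μ 0).prod (Measure.pi fun i => μ (Fin.succ i)) := by
        have := (measurePreserving_piFinSuccAbove μ 0).symm
        rw [← this.lintegral_comp_emb (MeasurableEquiv.measurableEmbedding _)]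
        simp [Fin.prod_univ_succ]
        rfl
      _ = _ := by
        rw [lintegral_prod_mul (hf 0).aemeasurable hm.aemeasurable, ih _ fun i => hf _,
          Fin.prod_univ_succ]

theorem lintegral_pi_prod_eq_prod {ι : Type*} [Fintype ι] {E : Type*} [MeasurableSpace E]
    (μ : Measure E) [SigmaFinite μ] {f : ι → E → ℝ≥0∞} (hf : ∀ i, Measurable (f i)) :
    ∫⁻ x, ∏ i, f i (x i) ∂Measure.pi (fun _ : ι => μ) = ∏ i, ∫⁻ x, f i x ∂μ := by
  let e := (Fintype.equivFin ι).symm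
  rw [← (measurePreserving_piCongrLeft (fun _ : ι => μ) e).lintegral_comp_emb
    (MeasurableEquiv.measurableEmbedding _)]
  simp_rw [← e.prod_comp, MeasurableEquiv.coe_piCongrLeft, Equiv.piCongrLeft_apply_apply]
  exact lintegral_fin_prod_eq_prod (fun _ => μ) fun i => hf (e i)

/-- A product of measures with densities has the product density. -/
theorem pi_withDensity_eq {ι : Type*} [Fintype ι] {E : Type*} [MeasurableSpace E]
    (μ : Measure E) [SigmaFinite μ] {f : E → ℝ≥0∞} (hf : Measurable f)
    [SigmaFinite (μ.withDensity f)] :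
    Measure.pi (fun _ : ι => μ.withDensity f)
      = (Measure.pi fun _ : ι => μ).withDensity fun x => ∏ i, f (x i) := by
  refine Measure.pi_eq fun s hs => ?_
  rw [withDensity_apply _ (MeasurableSet.univ_pi hs),
    ← lintegral_indicator (MeasurableSet.univ_pi hs)]
  have : ∀ x : ι → E, (Set.univ.pi s).indicator (fun x => ∏ i, f (x i)) x
      = ∏ i, (s i).indicator f (x i) := fun x => by
    by_cases hx : x ∈ Set.univ.pi s
    · rw [Set.indicator_of_mem hx]
      exact Finset.prod_congr rfl fun i _ => (Set.indicator_of_mem (hx i trivial) _).symm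
    · rw [Set.indicator_of_notMem hx]
      simp only [Set.mem_pi, Set.mem_univ, true_implies, not_forall] at hx
      obtain ⟨i, hi⟩ := hx
      exact (Finset.prod_eq_zero (Finset.mem_univ i) (Set.indicator_of_notMem hi _)).symm
  simp_rw [this]
  rw [lintegral_pi_prod_eq_prod μ fun i => hf.indicator (hs i)]
  exact Finset.prod_congr rfl fun i _ => by
    rw [lintegral_indicator (hs i), withDensity_apply _ (hs i)]

theorem map_withDensity_toLin' {ι : Type*} [Fintype ι] [DecidableEq ι] {A : Matrix ι ι ℝ}
    (hA : A.det ≠ 0) {p : (ι → ℝ) → ℝ≥0∞} (hp : Measurable p) :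
    (volume.withDensity p).map (Matrix.toLin' A)
      = volume.withDensity fun x => ENNReal.ofReal |A.det⁻¹| * p (Matrix.toLin' A⁻¹ x) := by
  have hAm : Measurable (Matrix.toLin' A) := (LinearMap.continuous_of_finiteDimensional _).measurable
  have hBm : Measurable (Matrix.toLin' A⁻¹) :=
    (LinearMap.continuous_of_finiteDimensional _).measurable
  have hBA : ∀ x, Matrix.toLin' A⁻¹ (Matrix.toLin' A x) = x := fun x => by
    simp [Matrix.mulVec_mulVec, Matrix.nonsing_inv_mul _ (isUnit_iff_ne_zero.2 hA)]
  ext s hs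
  rw [Measure.map_apply hAm hs, withDensity_apply _ (hAm hs), withDensity_apply _ hs,
    lintegral_const_mul (f := fun x => p (Matrix.toLin' A⁻¹ x)) _ (hp.comp hBm), ← smul_eq_mul, ← lintegral_smul_measure,
    ← Measure.restrict_smul, ← Real.map_matrix_volume_pi_eq_smul_volume_pi hA,
    setLIntegral_map (f := fun x => p (Matrix.toLin' A⁻¹ x)) hs (hp.comp hBm) hAm]
  simp_rw [hBA]

/-! ### Density and entropy of a Gaussian vector -/

theorem log_gaussianPDF {v : ℝ≥0} (hv : v ≠ 0) (x : ℝ) :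
    Real.log (gaussianPDF 0 v x).toReal
      = -(Real.log (2 * Real.pi * v) + x ^ 2 / v) / 2 := by
  have hv' : (0 : ℝ) < v := by positivity
  rw [toReal_gaussianPDF, gaussianPDFReal, Real.log_mul (by positivity) (by positivity),
    Real.log_exp, Real.log_inv, Real.log_sqrt (by positivity)]
  field_simp
  ring

open scoped MatrixOrder in
theorem map_ofLp_multivariateGaussian {ι : Type*} [Fintype ι] [DecidableEq ι]
    (K : Matrix ι ι ℝ) :
    (multivariateGaussian 0 K).map WithLp.ofLp
      = (Measure.pi fun _ => gaussianReal 0 1).map (Matrix.toLin' (CFC.sqrt K)) := by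
  rw [multivariateGaussian, ← map_pi_eq_stdGaussian, Measure.map_map (by fun_prop) (by fun_prop),
    Measure.map_map (by fun_prop) (by fun_prop)]
  congr 1
  ext x
  simp

theorem integral_sq_gaussianReal : ∫ x, x ^ 2 ∂gaussianReal 0 1 = 1 := by
  have h := variance_id_gaussianReal (μ := 0) (v := 1)
  rw [variance_of_integral_eq_zero (by fun_prop) (by simp)] at h
  simpa using h

theorem integrable_sq_gaussianReal : Integrable (fun x : ℝ => x ^ 2) (gaussianReal 0 1) :=
  (memLp_id_gaussianReal 2).integrable_sq

open scoped MatrixOrder in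
/-- A nondegenerate Gaussian vector has a positive density, whose logarithm has the expectation
`-(1/2) log ((2πe)^n det K)`. -/
theorem exists_density_multivariateGaussian {ι : Type*} [Fintype ι] [DecidableEq ι]
    {K : Matrix ι ι ℝ} (hK : K.PosDef) :
    ∃ g : (ι → ℝ) → ℝ≥0∞, Measurable g ∧ (∀ x, g x ≠ 0) ∧ (∀ x, g x ≠ ∞) ∧
      (multivariateGaussian 0 K).map WithLp.ofLp = volume.withDensity g ∧
      Integrable (fun x => Real.log (g x).toReal) ((multivariateGaussian 0 K).map WithLp.ofLp) ∧
      ∫ x, Real.log (g x).toReal ∂(multivariateGaussian 0 K).map WithLp.ofLp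
        = -(Fintype.card ι * (Real.log (2 * Real.pi) + 1) + Real.log K.det) / 2 := by
  set A := CFC.sqrt K with hAdef
  have hAA : A * A = K := by
    exact CFC.sqrt_mul_sqrt_self K hK.posSemidef.nonneg
  have hdet : A.det * A.det = K.det := by rw [← Matrix.det_mul, hAA]
  have hA : A.det ≠ 0 := fun h => hK.det_pos.ne' (by rw [← hdet, h, mul_zero])
  have hAm : Measurable (Matrix.toLin' A) :=
    (LinearMap.continuous_of_finiteDimensional _).measurable
  have hBm : Measurable (Matrix.toLin' A⁻¹) :=
    (LinearMap.continuous_of_finiteDimensional _).measurable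
  have hBA : ∀ x, Matrix.toLin' A⁻¹ (Matrix.toLin' A x) = x := fun x => by
    simp [Matrix.mulVec_mulVec, Matrix.nonsing_inv_mul _ (isUnit_iff_ne_zero.2 hA)]
  have hpm : Measurable fun x : ι → ℝ => ∏ i, gaussianPDF 0 1 (x i) :=
    Finset.measurable_prod _ fun i _ => (measurable_gaussianPDF _ _).comp (measurable_pi_apply i)
  have hpi : (Measure.pi fun _ : ι => gaussianReal 0 1)
      = volume.withDensity fun x => ∏ i, gaussianPDF 0 1 (x i) := by
    have h1 := gaussianReal_of_var_ne_zero 0 one_ne_zero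
    have : SigmaFinite (volume.withDensity (gaussianPDF 0 1)) := by
      rw [← h1]; infer_instance
    rw [h1, pi_withDensity_eq volume (measurable_gaussianPDF _ _)]
    rfl
  have hgm : Measurable fun x : ι → ℝ =>
      ENNReal.ofReal |A.det⁻¹| * ∏ i, gaussianPDF 0 1 (Matrix.toLin' A⁻¹ x i) :=
    (hpm.comp hBm).const_mul _
  -- Pulled back to the standard Gaussian variable `z`, the log-density is a constant plus a sum of
  -- one-coordinate functions, so its expectation only needs `𝔼[z_i²] = 1`.
  have hlog : ∀ z : ι → ℝ, Real.log (ENNReal.ofReal |A.det⁻¹|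
      * ∏ i, gaussianPDF 0 1 (Matrix.toLin' A⁻¹ (Matrix.toLin' A z) i)).toReal
      = -Real.log K.det / 2 + ∑ i, -(Real.log (2 * Real.pi) + z i ^ 2) / 2 := fun z => by
    have hne : ∀ i, (gaussianPDF 0 1 (z i)).toReal ≠ 0 := fun i =>
      (ENNReal.toReal_pos (gaussianPDF_pos 0 one_ne_zero _).ne' gaussianPDF_ne_top).ne'
    rw [hBA, ENNReal.toReal_mul, ENNReal.toReal_prod, ENNReal.toReal_ofReal (abs_nonneg _),
      Real.log_mul (by simpa using hA) (Finset.prod_ne_zero_iff.2 fun i _ => hne i),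
      Real.log_prod fun i _ => hne i, Real.log_abs, Real.log_inv, ← hdet,
      Real.log_mul hA hA]
    simp_rw [log_gaussianPDF one_ne_zero]
    simp only [NNReal.coe_one, mul_one, div_one]
    ring
  have hint1 : Integrable (fun x : ℝ => -(Real.log (2 * Real.pi) + x ^ 2) / 2)
      (gaussianReal 0 1) :=
    (((integrable_const _).add integrable_sq_gaussianReal).neg).div_const 2
  have hint : ∀ i : ι, Integrable (fun z : ι → ℝ => -(Real.log (2 * Real.pi) + z i ^ 2) / 2)
      (Measure.pi fun _ : ι => gaussianReal 0 1) := fun i =>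
    integrable_comp_eval (μ := fun _ : ι => gaussianReal 0 1)
      (f := fun x : ℝ => -(Real.log (2 * Real.pi) + x ^ 2) / 2) (i := i) hint1
  refine ⟨_, hgm, fun x => ?_, fun x => ?_, ?_, ?_, ?_⟩
  · refine mul_ne_zero (by simpa using hA) (Finset.prod_ne_zero_iff.2 fun i _ => ?_)
    exact (gaussianPDF_pos 0 one_ne_zero _).ne'
  · exact ENNReal.mul_ne_top ENNReal.ofReal_ne_top
      (ENNReal.prod_ne_top fun i _ => gaussianPDF_ne_top)
  · rw [map_ofLp_multivariateGaussian, hpi]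
    exact map_withDensity_toLin' hA hpm
  · rw [map_ofLp_multivariateGaussian,
      integrable_map_measure (hgm.ennreal_toReal.log).aestronglyMeasurable hAm.aemeasurable]
    refine Integrable.congr ((integrable_const _).add (integrable_finsetSum _ fun i _ => hint i))
      (Filter.Eventually.of_forall fun z => (hlog z).symm)
  · rw [map_ofLp_multivariateGaussian,
      integral_map hAm.aemeasurable (hgm.ennreal_toReal.log).aestronglyMeasurable]
    have h1 : ∫ x, -(Real.log (2 * Real.pi) + x ^ 2) / 2 ∂gaussianReal 0 1
        = -(Real.log (2 * Real.pi) + 1) / 2 := by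
      rw [integral_div, integral_neg, integral_add (integrable_const _)
        integrable_sq_gaussianReal, integral_sq_gaussianReal]
      simp
    have h2 : ∀ i : ι, ∫ z : ι → ℝ, -(Real.log (2 * Real.pi) + z i ^ 2) / 2
        ∂(Measure.pi fun _ : ι => gaussianReal 0 1) = -(Real.log (2 * Real.pi) + 1) / 2 :=
      fun i => by
        rw [← h1]
        exact integral_comp_eval (μ := fun _ : ι => gaussianReal 0 1) (i := i)
          hint1.aestronglyMeasurable
    simp_rw [hlog]
    rw [integral_add (integrable_const _) (integrable_finsetSum _ fun i _ => hint i),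
      integral_finsetSum _ fun i _ => hint i]
    simp_rw [h2]
    simp only [integral_const, probReal_univ, one_smul, Finset.sum_const, Finset.card_univ,
      nsmul_eq_mul]
    ring

/-! ### Conditional densities and the converse in nats -/

section

variable {Ω γ : Type*} [MeasurableSpace Ω] [MeasurableSpace γ] {P : Measure Ω}
  {X Y : Ω → ℝ} {U : Ω → γ}

/-- The joint density of `(U, X)` with respect to the law of `U` times Lebesgue measure, that is,
the conditional density of `X` given `U`. -/
noncomputable def condDensity (X : Ω → ℝ) (U : Ω → γ) (P : Measure Ω) : γ × ℝ → ℝ≥0∞ :=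
  (P.map fun ω => (U ω, X ω)).rnDeriv ((P.map U).prod volume)

theorem measurable_condDensity : Measurable (condDensity X U P) :=
  Measure.measurable_rnDeriv _ _

variable [IsProbabilityMeasure P]

/-- Integrated over any measurable set `s` of values of `U`, the left side is at most the joint mass
of `s × ℝ`, which is the mass of `s`. No absolute continuity is needed for the inequality. -/
theorem lintegral_condDensity_le_one (hX : Measurable X) (hU : Measurable U) :
    ∀ᵐ u ∂P.map U, ∫⁻ x, condDensity X U P (u, x) ≤ 1 := by
  have := Measure.isProbabilityMeasure_map hU.aemeasurable (μ := P)
  refine ae_le_of_forall_setLIntegral_le_of_sigmaFinite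
    measurable_condDensity.lintegral_prod_right' fun s hs _ => ?_
  have h1 : ∫⁻ u in s, (∫⁻ x, condDensity X U P (u, x)) ∂P.map U
      = ∫⁻ z in s ×ˢ Set.univ, condDensity X U P z ∂(P.map U).prod volume := by
    rw [← Measure.prod_restrict, Measure.restrict_univ,
      lintegral_prod _ measurable_condDensity.aemeasurable]
  rw [h1, setLIntegral_const, one_mul, Measure.map_apply hU hs]
  refine (Measure.setLIntegral_rnDeriv_le _).trans ?_
  rw [Measure.map_apply (hU.prodMk hX) (hs.prod MeasurableSet.univ)]
  exact measure_mono fun ω hω => hω.1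

/-- Rewriting the law of `(U, X)` as `q` times (law of `U`) × Lebesgue cancels the denominator.
Tonelli then allows `x` to be integrated first, where `w (·, y)` has mass at most 1. -/
theorem lintegral_div_condDensity_le_one (hX : Measurable X) (hU : Measurable U)
    (hac : P.map (fun ω => (U ω, X ω)) ≪ (P.map U).prod volume)
    {w : ℝ × ℝ → ℝ≥0∞} (hw : Measurable w) (hw1 : ∀ y, ∫⁻ x, w (x, y) ≤ 1) :
    ∫⁻ z, w z.2 / condDensity X U P (z.1, z.2.1)
      ∂((P.map U) ⊗ₘ (condDistrib X U P ×ₖ condDistrib Y U P)) ≤ 1 := by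
  have := Measure.isProbabilityMeasure_map hU.aemeasurable (μ := P)
  have hq := measurable_condDensity (X := X) (U := U) (P := P)
  set q := condDensity X U P
  set η := condDistrib Y U P
  have hm : Measurable fun z : γ × ℝ × ℝ => w z.2 / q (z.1, z.2.1) := by fun_prop
  have hm' : Measurable fun z : (γ × ℝ) × ℝ => w (z.1.2, z.2) / q z.1 := by fun_prop
  have hm'' : Measurable fun z : (γ × ℝ) × ℝ => w (z.1.2, z.2) := by fun_prop
  let η' : Kernel (γ × ℝ) ℝ := η.comap Prod.fst measurable_fst
  have hH : Measurable fun z : γ × ℝ => ∫⁻ y, w (z.2, y) / q z ∂η z.1 :=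
    hm'.lintegral_kernel_prod_right' (κ := η')
  have hH' : Measurable fun z : γ × ℝ => ∫⁻ y, w (z.2, y) ∂η z.1 :=
    hm''.lintegral_kernel_prod_right' (κ := η')
  calc ∫⁻ z, w z.2 / q (z.1, z.2.1) ∂((P.map U) ⊗ₘ (condDistrib X U P ×ₖ η))
    _ = ∫⁻ u, ∫⁻ x, ∫⁻ y, w (x, y) / q (u, x) ∂η u ∂condDistrib X U P u ∂P.map U := by
      rw [Measure.lintegral_compProd hm]
      refine lintegral_congr fun u => ?_
      rw [Kernel.lintegral_prod _ _ _ (by fun_prop)]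
    _ = ∫⁻ z, ∫⁻ y, w (z.2, y) / q z ∂η z.1 ∂P.map fun ω => (U ω, X ω) := by
      rw [← compProd_map_condDistrib hX.aemeasurable, Measure.lintegral_compProd hH]
    _ = ∫⁻ z, q z * ∫⁻ y, w (z.2, y) / q z ∂η z.1 ∂(P.map U).prod volume :=
      (lintegral_rnDeriv_mul hac hH.aemeasurable).symm
    _ ≤ ∫⁻ z, ∫⁻ y, w (z.2, y) ∂η z.1 ∂(P.map U).prod volume := by
      refine lintegral_mono fun z => ?_
      dsimp only
      rw [← lintegral_const_mul _ (by fun_prop)]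
      exact lintegral_mono fun y => ENNReal.mul_div_le
    _ = ∫⁻ u, ∫⁻ y, (∫⁻ x, w (x, y)) ∂η u ∂P.map U := by
      rw [lintegral_prod _ hH'.aemeasurable]
      refine lintegral_congr fun u => ?_
      exact lintegral_lintegral_swap (μ := volume) (ν := η u) (f := fun x y => w (x, y))
        hw.aemeasurable
    _ ≤ ∫⁻ u, ∫⁻ _y, 1 ∂η u ∂P.map U :=
      lintegral_mono fun u => lintegral_mono fun y => hw1 y
    _ = 1 := by simp

/-- Under the product law `π(W)` still has density `g` for each fixed `u`, so `g` cancels and the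
integral of `∏ q_i` factors over coordinates. This encodes subadditivity of entropy together with
data processing from `W` to `π(W)`. -/
theorem lintegral_prod_condDensity_div_le_one {V ι : Type*} [MeasurableSpace V] [Fintype ι]
    {W : Ω → V} {π : V → ι → ℝ} (hW : Measurable W) (hπ : Measurable π) (hU : Measurable U)
    {g : (ι → ℝ) → ℝ≥0∞} (hg : Measurable g)
    (hlaw : P.map (fun ω => π (W ω)) = volume.withDensity g) :
    ∫⁻ z, (∏ i, condDensity (fun ω => π (W ω) i) U P (z.2, π z.1 i)) / g (π z.1)
      ∂(P.map W).prod (P.map U) ≤ 1 := by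
  have := Measure.isProbabilityMeasure_map hU.aemeasurable (μ := P)
  have := Measure.isProbabilityMeasure_map hW.aemeasurable (μ := P)
  have hXi : ∀ i, Measurable fun ω => π (W ω) i := fun i =>
    (measurable_pi_apply i).comp (hπ.comp hW)
  have hq := fun i => measurable_condDensity (X := fun ω => π (W ω) i) (U := U) (P := P)
  set q := fun i => condDensity (fun ω => π (W ω) i) U P
  have hqm : ∀ i, Measurable (q i) := hq
  have hm : Measurable fun z : V × γ => (∏ i, q i (z.2, π z.1 i)) / g (π z.1) := by fun_prop
  have hle : ∀ᵐ u ∂P.map U, ∀ i, ∫⁻ x, q i (u, x) ≤ 1 :=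
    ae_all_iff.2 fun i => lintegral_condDensity_le_one (hXi i) hU
  change ∫⁻ z, (∏ i, q i (z.2, π z.1 i)) / g (π z.1) ∂(P.map W).prod (P.map U) ≤ 1
  rw [lintegral_prod_symm _ hm.aemeasurable]
  calc ∫⁻ u, ∫⁻ v, (∏ i, q i (u, π v i)) / g (π v) ∂P.map W ∂P.map U
    _ ≤ ∫⁻ _u, 1 ∂P.map U := by
      refine lintegral_mono_ae ?_
      filter_upwards [hle] with u hu
      have hmu : Measurable fun x : ι → ℝ => (∏ i, q i (u, x i)) / g x := by fun_prop
      have h1 : ∫⁻ v, (∏ i, q i (u, π v i)) / g (π v) ∂P.map W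
          = ∫⁻ x, (∏ i, q i (u, x i)) / g x ∂volume.withDensity g := by
        rw [← hlaw, lintegral_map hmu (g := fun ω => π (W ω)) (hπ.comp hW),
          lintegral_map (f := fun v => (∏ i, q i (u, π v i)) / g (π v)) (hmu.comp hπ) hW]
      rw [h1, lintegral_withDensity_eq_lintegral_mul _ hg hmu]
      calc _ ≤ ∫⁻ x : ι → ℝ, ∏ i, q i (u, x i) := lintegral_mono fun x => ENNReal.mul_div_le
        _ = ∏ i, ∫⁻ x, q i (u, x) :=
          lintegral_pi_prod_eq_prod volume fun i => (hqm i).comp measurable_prodMk_left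
        _ ≤ 1 := Finset.prod_le_one' fun i _ => hu i
    _ = 1 := by simp

/-- The Gaussian rate-distortion converse with side information `U`, in nats: the sum of the
conditional information rates is at least `h(X) - I(X; U)` minus the entropies of the
distortions. -/
theorem sum_klDiv_add_klDiv_ge {V ι : Type*} [MeasurableSpace V] [Fintype ι]
    {W : Ω → V} {π : V → ι → ℝ} {Y : ι → Ω → ℝ} (hW : Measurable W) (hπ : Measurable π)
    (hU : Measurable U) (hY : ∀ i, Measurable (Y i))
    {g : (ι → ℝ) → ℝ≥0∞} (hg : Measurable g) (hg0 : ∀ x, g x ≠ 0) (hgt : ∀ x, g x ≠ ∞)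
    (hlaw : P.map (fun ω => π (W ω)) = volume.withDensity g)
    (hgint : Integrable (fun x => Real.log (g x).toReal) (P.map fun ω => π (W ω)))
    {v : ℝ≥0} (hv : v ≠ 0)
    (hdist : ∀ i, ∫⁻ ω, ENNReal.ofReal ((π (W ω) i - Y i ω) ^ 2) ∂P ≤ v)
    (hcache : klDiv (P.map fun ω => (W ω, U ω)) ((P.map W).prod (P.map U)) ≠ ∞)
    (hrate : ∀ i, klDiv (P.map fun ω => (U ω, (π (W ω) i, Y i ω)))
      ((P.map U) ⊗ₘ (condDistrib (fun ω => π (W ω) i) U P ×ₖ condDistrib (Y i) U P)) ≠ ∞) :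
    -(Fintype.card ι * (Real.log (2 * Real.pi * v) + 1)) / 2
        - ∫ x, Real.log (g x).toReal ∂(P.map fun ω => π (W ω))
      ≤ (∑ i, (klDiv (P.map fun ω => (U ω, (π (W ω) i, Y i ω)))
          ((P.map U) ⊗ₘ (condDistrib (fun ω => π (W ω) i) U P ×ₖ condDistrib (Y i) U P))).toReal)
        + (klDiv (P.map fun ω => (W ω, U ω)) ((P.map W).prod (P.map U))).toReal := by
  have := Measure.isProbabilityMeasure_map hU.aemeasurable (μ := P)
  have := Measure.isProbabilityMeasure_map hW.aemeasurable (μ := P)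
  have := Measure.isProbabilityMeasure_map (hW.prodMk hU).aemeasurable (μ := P)
  have hXi : ∀ i, Measurable fun ω => π (W ω) i := fun i =>
    (measurable_pi_apply i).comp (hπ.comp hW)
  have hUXY : ∀ i, Measurable fun ω => (U ω, (π (W ω) i, Y i ω)) := fun i =>
    hU.prodMk ((hXi i).prodMk (hY i))
  have := fun i => Measure.isProbabilityMeasure_map (hUXY i).aemeasurable (μ := P)
  have hXac : ∀ i, P.map (fun ω => π (W ω) i) ≪ volume := fun i => by
    have h1 : P.map (fun ω => π (W ω)) ≪ volume := hlaw ▸ withDensity_absolutelyContinuous _ _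
    have h2 := h1.map (measurable_pi_apply (X := fun _ : ι => ℝ) i)
    rw [Measure.map_map (f := fun ω => π (W ω)) (measurable_pi_apply i) (hπ.comp hW)] at h2
    exact h2.trans (Measure.quasiMeasurePreserving_eval _ i).absolutelyContinuous
  -- Finite cache information makes the law of `(W, U)` absolutely continuous with respect to the
  -- product of its marginals; projecting to `(U, X_i)` gives a genuine conditional density.
  have hac : ∀ i, P.map (fun ω => (U ω, π (W ω) i)) ≪ (P.map U).prod volume := fun i => by
    have h1 := (klDiv_ne_top_iff.1 hcache).1
    have hf : Measurable fun z : V × γ => (z.2, π z.1 i) :=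
      measurable_snd.prodMk ((measurable_pi_apply i).comp (hπ.comp measurable_fst))
    have hπi : Measurable fun x : V => π x i := (measurable_pi_apply i).comp hπ
    have h2 := h1.map hf
    rw [Measure.map_map hf (hW.prodMk hU)] at h2
    have h3 : ((P.map W).prod (P.map U)).map (fun z : V × γ => (z.2, π z.1 i))
        = (P.map U).prod (P.map fun ω => π (W ω) i) := by
      have : (fun z : V × γ => (z.2, π z.1 i)) = Prod.map id (fun x => π x i) ∘ Prod.swap := rfl
      rw [this, ← Measure.map_map (measurable_id.prodMap hπi) measurable_swap, Measure.prod_swap,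
        ← Measure.map_prod_map _ _ measurable_id hπi, Measure.map_id, Measure.map_map hπi hW]
      rfl
    rw [h3] at h2
    exact h2.trans (Measure.AbsolutelyContinuous.rfl.prod (hXac i))
  have hqm := fun i => measurable_condDensity (X := fun ω => π (W ω) i) (U := U) (P := P)
  have hq : ∀ i, ∀ᵐ ω ∂P, 0 < condDensity (fun ω => π (W ω) i) U P (U ω, π (W ω) i) ∧
      condDensity (fun ω => π (W ω) i) U P (U ω, π (W ω) i) < ∞ := fun i => by
    have h1 := Measure.rnDeriv_pos (hac i)
    have h2 := (hac i).ae_le (Measure.rnDeriv_lt_top (P.map fun ω => (U ω, π (W ω) i))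
      ((P.map U).prod volume))
    exact ae_of_ae_map (hU.prodMk (hXi i)).aemeasurable (h1.and h2)
  let q := fun i => condDensity (fun ω => π (W ω) i) U P
  have hqm : ∀ i, Measurable (q i) := fun i => measurable_condDensity
  let w : ℝ × ℝ → ℝ≥0∞ := fun z => gaussianPDF 0 v (z.1 - z.2)
  have hw : Measurable w :=
    (measurable_gaussianPDF 0 v).comp (measurable_fst.sub measurable_snd)
  have hw0 : ∀ z, w z ≠ 0 := fun z => (gaussianPDF_pos 0 hv _).ne'
  have hwt : ∀ z, w z ≠ ∞ := fun z => gaussianPDF_ne_top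
  have hw1 : ∀ y, ∫⁻ x, w (x, y) ≤ 1 := fun y => by
    rw [lintegral_sub_right_eq_self (gaussianPDF 0 v) y, lintegral_gaussianPDF_eq_one 0 hv]
  have hfm : ∀ i, Measurable fun z : γ × ℝ × ℝ => w z.2 / q i (z.1, z.2.1) := fun i => by
    fun_prop
  have hf0m : Measurable fun z : V × γ => (∏ i, q i (z.2, π z.1 i)) / g (π z.1) := by
    fun_prop
  have hb : ∀ i, _ := fun i =>
    exists_integrable_log_le_of_klDiv_ne_top (hrate i) (hfm i)
      (lintegral_div_condDensity_le_one (hXi i) hU (hac i) hw hw1)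
      ((ae_map_iff (hUXY i).aemeasurable (hfm i (measurableSet_singleton 0).compl)).2 <| by
        filter_upwards [hq i] with ω hω using ENNReal.div_ne_zero.2 ⟨hw0 _, hω.2.ne⟩)
      ((ae_map_iff (hUXY i).aemeasurable (hfm i (measurableSet_singleton ∞).compl)).2 <| by
        filter_upwards [hq i] with ω hω using ENNReal.div_ne_top (hwt _) hω.1.ne')
  choose h hhint hhle hhlog using hb
  obtain ⟨h₀, h₀int, h₀le, h₀log⟩ :=
    exists_integrable_log_le_of_klDiv_ne_top hcache hf0m
      (lintegral_prod_condDensity_div_le_one hW hπ hU hg hlaw)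
      ((ae_map_iff (hW.prodMk hU).aemeasurable (hf0m (measurableSet_singleton 0).compl)).2 <| by
        filter_upwards [ae_all_iff.2 hq] with ω hω using
          ENNReal.div_ne_zero.2 ⟨Finset.prod_ne_zero_iff.2 fun i _ => (hω i).1.ne', hgt _⟩)
      ((ae_map_iff (hW.prodMk hU).aemeasurable (hf0m (measurableSet_singleton ∞).compl)).2 <| by
        filter_upwards [ae_all_iff.2 hq] with ω hω using
          ENNReal.div_ne_top (ENNReal.prod_ne_top fun i _ => (hω i).2.ne) (hg0 _))
  have hπW : Measurable fun ω => π (W ω) := hπ.comp hW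
  have hlogg := hg.ennreal_toReal.log
  have hsq : ∀ i, Integrable (fun ω => (π (W ω) i - Y i ω) ^ 2) P ∧
      ∫ ω, (π (W ω) i - Y i ω) ^ 2 ∂P ≤ v := fun i => by
    have hm : Measurable fun ω => (π (W ω) i - Y i ω) ^ 2 := ((hXi i).sub (hY i)).pow_const 2
    refine ⟨(lintegral_ofReal_ne_top_iff_integrable hm.aestronglyMeasurable
      (Filter.Eventually.of_forall fun ω => sq_nonneg _)).1
      (ne_top_of_le_ne_top ENNReal.coe_ne_top (hdist i)), ?_⟩
    rw [integral_eq_lintegral_of_nonneg_ae (Filter.Eventually.of_forall fun ω => sq_nonneg _)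
      hm.aestronglyMeasurable]
    exact ENNReal.toReal_mono ENNReal.coe_ne_top (hdist i)
  have hφint : ∀ i, Integrable (fun ω =>
      -(Real.log (2 * Real.pi * v) + (π (W ω) i - Y i ω) ^ 2 / v) / 2) P := fun i =>
    (((integrable_const _).add ((hsq i).1.div_const _)).neg).div_const 2
  have hgP : Integrable (fun ω => Real.log (g (π (W ω))).toReal) P :=
    (integrable_map_measure hlogg.aestronglyMeasurable hπW.aemeasurable).1 hgint
  have hhP : ∀ i, Integrable (fun ω => h i (U ω, (π (W ω) i, Y i ω))) P := fun i =>
    (integrable_map_measure (hhint i).1 (hUXY i).aemeasurable).1 (hhint i)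
  have h₀P : Integrable (fun ω => h₀ (W ω, U ω)) P :=
    (integrable_map_measure h₀int.1 (hW.prodMk hU).aemeasurable).1 h₀int
  -- The terms `log q_i` occur with opposite signs in the rate and cache bounds and cancel
  -- pointwise, so their integrability is never required.
  have key : ∫ ω, (∑ i, -(Real.log (2 * Real.pi * v) + (π (W ω) i - Y i ω) ^ 2 / v) / 2
        - Real.log (g (π (W ω))).toReal) ∂P
      ≤ ∫ ω, (∑ i, h i (U ω, (π (W ω) i, Y i ω)) + h₀ (W ω, U ω)) ∂P := by
    refine integral_mono_ae ((integrable_finsetSum _ fun i _ => hφint i).sub hgP)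
      ((integrable_finsetSum _ fun i _ => hhP i).add h₀P) ?_
    filter_upwards [ae_all_iff.2 fun i => ae_of_ae_map (hUXY i).aemeasurable (hhlog i),
      ae_of_ae_map (hW.prodMk hU).aemeasurable h₀log, ae_all_iff.2 hq] with ω h1 h2 h3
    have hq0 : ∀ i, (q i (U ω, π (W ω) i)).toReal ≠ 0 := fun i =>
      (ENNReal.toReal_pos (h3 i).1.ne' (h3 i).2.ne).ne'
    have h4 : ∀ i, -(Real.log (2 * Real.pi * v) + (π (W ω) i - Y i ω) ^ 2 / v) / 2
        - Real.log (q i (U ω, π (W ω) i)).toReal ≤ h i (U ω, (π (W ω) i, Y i ω)) := fun i => by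
      refine le_trans (le_of_eq ?_) (h1 i)
      rw [ENNReal.toReal_div, Real.log_div (ENNReal.toReal_pos (hw0 _) (hwt _)).ne' (hq0 i),
        log_gaussianPDF hv]
    have h5 : (∑ i, Real.log (q i (U ω, π (W ω) i)).toReal) - Real.log (g (π (W ω))).toReal
        ≤ h₀ (W ω, U ω) := by
      refine le_trans (le_of_eq ?_) h2
      rw [ENNReal.toReal_div, ENNReal.toReal_prod,
        Real.log_div (Finset.prod_ne_zero_iff.2 fun i _ => hq0 i)
          (ENNReal.toReal_pos (hg0 _) (hgt _)).ne', Real.log_prod fun i _ => hq0 i]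
    have h6 := Finset.sum_le_sum fun i (_ : i ∈ Finset.univ) => h4 i
    rw [Finset.sum_sub_distrib] at h6
    linarith
  rw [integral_sub (integrable_finsetSum _ fun i _ => hφint i) hgP,
    integral_add (integrable_finsetSum _ fun i _ => hhP i) h₀P,
    integral_finsetSum _ fun i _ => hφint i, integral_finsetSum _ fun i _ => hhP i] at key
  -- Taking the variance of `w` equal to the distortion level bounds the expected quadratic term by
  -- 1.
  have hφ : ∀ i, -(Real.log (2 * Real.pi * v) + 1) / 2
      ≤ ∫ ω, -(Real.log (2 * Real.pi * v) + (π (W ω) i - Y i ω) ^ 2 / v) / 2 ∂P := fun i => by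
    rw [integral_div, integral_neg, integral_add (integrable_const _) ((hsq i).1.div_const _),
      integral_div]
    have hv' : (0 : ℝ) < v := by positivity
    have := (div_le_one hv').2 (hsq i).2
    simp only [integral_const, probReal_univ, one_smul]
    linarith
  have hφs := Finset.sum_le_sum fun i (_ : i ∈ Finset.univ) => hφ i
  have hhs := Finset.sum_le_sum fun i (_ : i ∈ Finset.univ) => hhle i
  simp_rw [integral_map (hUXY _).aemeasurable (hhint _).1] at hhs
  rw [integral_map (hW.prodMk hU).aemeasurable h₀int.1] at h₀le
  rw [integral_map hπW.aemeasurable hlogg.aestronglyMeasurable]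
  rw [Finset.sum_const, Finset.card_univ, nsmul_eq_mul] at hφs
  linarith

end

/-! ### Subvectors of a Gaussian vector -/

/-- A coordinate projection is linear, so the image is Gaussian and is determined by its mean and
covariance. -/
theorem map_restrict_multivariateGaussian {L : ℕ} {K : Matrix (Fin L) (Fin L) ℝ}
    (hK : K.PosSemidef) (S : Finset (Fin L)) :
    (multivariateGaussian 0 K).map (fun x (i : S) => x i)
      = (multivariateGaussian 0 (subCov K S)).map WithLp.ofLp := by
  let R : EuclideanSpace ℝ (Fin L) →L[ℝ] EuclideanSpace ℝ S :=
    (EuclideanSpace.equiv S ℝ).symm.toContinuousLinearMap ∘L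
      ContinuousLinearMap.pi fun i : S => EuclideanSpace.proj (i : Fin L)
  have hR : ∀ x (i : S), R x i = x i := fun _ _ => rfl
  have hmap : (multivariateGaussian 0 K).map R = multivariateGaussian 0 (subCov K S) := by
    apply IsGaussian.ext
    · simp only [id_eq, integral_id_multivariateGaussian]
      rw [ContinuousLinearMap.integral_id_map, integral_id_multivariateGaussian, map_zero]
      exact IsGaussian.integrable_id
    rw [← ContinuousLinearMap.toBilinForm_inj]
    refine LinearMap.BilinForm.ext_basis (EuclideanSpace.basisFun S ℝ).toBasis fun i j => ?_
    rw [ContinuousLinearMap.toBilinForm_apply, ContinuousLinearMap.toBilinForm_apply,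
      covarianceBilin_apply_eq_cov, covariance_map]
    · have (i : S) : (fun u => inner ℝ ((EuclideanSpace.basisFun S ℝ).toBasis i) u) ∘ R
          = fun u : EuclideanSpace ℝ (Fin L) => u i := by
        ext; simp [PiLp.inner_apply, hR]
      simp_rw [this, covariance_eval_multivariateGaussian hK,
        covarianceBilin_multivariateGaussian (S := subCov K S) (hK.submatrix _)]
      simp [subCov]
    any_goals exact Measurable.aestronglyMeasurable (by fun_prop)
    · fun_prop
    · exact IsGaussian.memLp_two_id
  rw [← hmap, Measure.map_map (by fun_prop) (by fun_prop)]
  rfl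

/-! ### From nats to bits, and the final bound -/

theorem toReal_le_of_div_log_two_le {a : ℝ≥0∞} {b : ℝ} (hb : 0 ≤ b)
    (h : a / ENNReal.ofReal (Real.log 2) ≤ ENNReal.ofReal b) :
    a ≠ ∞ ∧ a.toReal ≤ b * Real.log 2 := by
  have hl : 0 < Real.log 2 := Real.log_pos one_lt_two
  have h1 : a ≤ ENNReal.ofReal (b * Real.log 2) := by
    rw [ENNReal.ofReal_mul hb]
    exact (ENNReal.div_le_iff (by simpa using hl) ENNReal.ofReal_ne_top).1 h
  exact ⟨ne_top_of_le_ne_top ENNReal.ofReal_ne_top h1,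
    ENNReal.toReal_le_of_le_ofReal (by positivity) h1⟩

/-- The subset bound for positive distortion, for a single feasible joint law, in nats. -/
theorem log_det_le_of_feasible {L : ℕ} {K : Matrix (Fin L) (Fin L) ℝ} (hK : K.PosSemidef)
    {D C : ℝ≥0} (hD : D ≠ 0) {P : Measure (RDCSpace L)} [IsProbabilityMeasure P]
    (hP : IsGaussianRDCFeasible K (fun _ => D) C P) {S : Finset (Fin L)}
    (hS : 0 < (subCov K S).det) {M : ℝ} (hM : 0 ≤ M)
    (hrate : ∀ l, condMutualInfo (fun ω : RDCSpace L => ω.1 l) (fun ω => ω.2.2 l)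
      (fun ω => ω.2.1) P ≤ ENNReal.ofReal M) :
    (Real.log (subCov K S).det - S.card * Real.log D) / 2 ≤ (S.card * M + C) * Real.log 2 := by
  have hpd : (subCov K S).PosDef :=
    ((hK.submatrix _).posDef_iff_isUnit.2 ((Matrix.isUnit_iff_isUnit_det _).2 hS.ne'.isUnit))
  obtain ⟨g, hg, hg0, hgt, hlaw, hgint, hgval⟩ := exists_density_multivariateGaussian hpd
  have hπ : Measurable fun (x : EuclideanSpace ℝ (Fin L)) (i : S) => x i := by fun_prop
  have hπP : P.map (fun ω : RDCSpace L => fun i : S => ω.1 i)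
      = (multivariateGaussian 0 (subCov K S)).map WithLp.ofLp := by
    rw [← map_restrict_multivariateGaussian hK, ← hP.source_law,
      Measure.map_map hπ measurable_fst]
    rfl
  have hr : ∀ i : S, _ := fun i => toReal_le_of_div_log_two_le hM (hrate i)
  have hc := toReal_le_of_div_log_two_le C.2 (hP.cache_le.trans_eq (by simp))
  have hmain := sum_klDiv_add_klDiv_ge (P := P) (W := fun ω : RDCSpace L => ω.1)
    (π := fun x (i : S) => x i) (U := fun ω => ω.2.1) (Y := fun i ω => ω.2.2 i)
    measurable_fst hπ (by fun_prop) (fun i => by fun_prop) hg hg0 hgt (hπP.trans hlaw)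
    (hπP ▸ hgint) hD (fun i => hP.distortion_le i) hc.1 fun i => (hr i).1
  rw [hπP, hgval] at hmain
  have hsum := Finset.sum_le_sum fun i (_ : i ∈ Finset.univ) => (hr i).2
  have hcc := hc.2
  rw [Finset.sum_const, Finset.card_univ, nsmul_eq_mul, Fintype.card_coe] at hsum
  rw [Fintype.card_coe, Real.log_mul (by positivity) (by positivity)] at hmain
  have := hmain.trans (add_le_add hsum hcc)
  simp only [NNReal.val_eq_coe] at this
  linarith

/-- The subset bound in bits, for a single feasible joint law. -/
theorem subsetBound_le_of_feasible {L : ℕ} {K : Matrix (Fin L) (Fin L) ℝ} (hK : K.PosSemidef)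
    {D C : ℝ≥0} {P : Measure (RDCSpace L)} [IsProbabilityMeasure P]
    (hP : IsGaussianRDCFeasible K (fun _ => D) C P) {S : Finset (Fin L)} (hS : S.Nonempty)
    {M : ℝ≥0∞} (hrate : ∀ l, condMutualInfo (fun ω : RDCSpace L => ω.1 l) (fun ω => ω.2.2 l)
      (fun ω => ω.2.1) P ≤ M) :
    subsetBound K D C S ≤ (M : EReal) := by
  have hn : (0 : ℝ) < S.card := by exact_mod_cast hS.card_pos
  have hl : 0 < Real.log 2 := Real.log_pos one_lt_two
  have hc : (0 : ℝ) < 1 / (2 * S.card) := by positivity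
  rcases le_or_gt (subCov K S).det 0 with hdet | hdet
  · have : subsetBound K D C S = ⊥ := by
      rw [subsetBound, log2, ENNReal.ofReal_of_nonpos hdet, ENNReal.zero_div, ENNReal.log_zero,
        EReal.bot_div_of_pos_ne_top (by exact_mod_cast hl) (EReal.coe_ne_top _),
        EReal.coe_mul_bot_of_pos hc, EReal.bot_sub]
    rw [this]
    exact bot_le
  induction M with
  | top => simp
  | coe m =>
    have hrate' : ∀ l, condMutualInfo (fun ω : RDCSpace L => ω.1 l) (fun ω => ω.2.2 l)
      (fun ω => ω.2.1) P ≤ ENNReal.ofReal m := by simpa using hrate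
    have hD : D ≠ 0 := by
      rintro rfl
      set c := (S.card * m + C) * Real.log 2
      -- A law feasible for `D = 0` is feasible for every distortion `exp (-t)`. This `t` is chosen
      -- so that the bound in nats would read `S.card ≤ 0`.
      set t := (2 * c - Real.log (subCov K S).det) / S.card + 1 with ht
      have hP' : IsGaussianRDCFeasible K (fun _ => (Real.exp (-t)).toNNReal) C P :=
        ⟨hP.source_law, hP.cache_le, fun l => (hP.distortion_le l).trans (by simp)⟩
      have h := log_det_le_of_feasible hK (by simpa using Real.exp_pos (-t)) hP' hdet m.2 hrate'
      rw [Real.coe_toNNReal _ (Real.exp_pos _).le, Real.log_exp] at h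
      have h2 : S.card * t = 2 * c - Real.log (subCov K S).det + S.card := by
        rw [ht]; field_simp
      change _ ≤ c at h
      linarith
    have h := log_det_le_of_feasible hK hD hP hdet m.2 hrate'
    have hD' : (0 : ℝ) < D := by positivity
    have hq : ENNReal.ofReal (subCov K S).det / (D : ℝ≥0∞) ^ S.card
        = ENNReal.ofReal ((subCov K S).det / D ^ S.card) := by
      rw [ENNReal.ofReal_div_of_pos (by positivity), ENNReal.ofReal_pow D.coe_nonneg,
        ENNReal.ofReal_coe_nnreal]
    rw [subsetBound, log2, hq, ENNReal.log_ofReal_of_pos (by positivity), ← EReal.coe_div,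
      ← EReal.coe_mul, ← EReal.coe_sub]
    change _ ≤ ((m : ℝ) : EReal)
    rw [EReal.coe_le_coe_iff, Real.log_div hdet.ne' (by positivity), Real.log_pow]
    have : 1 / (2 * (S.card : ℝ)) * ((Real.log (subCov K S).det - S.card * Real.log D) / Real.log 2)
        - C / S.card = ((Real.log (subCov K S).det - S.card * Real.log D) / 2
          - C * Real.log 2) / (S.card * Real.log 2) := by
      field_simp
    rw [this, div_le_iff₀ (by positivity)]
    change _ ≤ (S.card * (m : ℝ) + C) * Real.log 2 at h
    linarith

theorem mainTheorem8 {L : ℕ} (K : Matrix (Fin L) (Fin L) ℝ) (hK : K.PosSemidef) (D C : ℝ≥0) :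
    ((Finset.univ : Finset (Finset (Fin L))).filter (fun S => S.Nonempty)).sup
        (fun S => subsetBound K D C S)
      ≤ ((gaussianRDC K (fun _ => D) C : ℝ≥0∞) : EReal) := by
  refine Finset.sup_le fun S hS => ?_
  have hS' : S.Nonempty := (Finset.mem_filter.1 hS).2
  -- The bracket may be negative; replacing it by its positive part moves the comparison into `[0,
  -- ∞]`, where the infimum is taken.
  refine ((le_max_right _ _).trans_eq EReal.coe_toENNReal_eq_max.symm).trans (EReal.coe_ennreal_le_coe_ennreal_iff.2 ?_)
  refine le_iInf₂ fun P hP => ?_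
  rw [← EReal.toENNReal_coe (x := ⨆ l, _)]
  exact EReal.toENNReal_le_toENNReal
    (subsetBound_le_of_feasible hK hP hS' fun l => le_iSup_iff.2 fun b hb => hb l)
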